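/- **Setting.** ABS is an active object language. Objects communicate by asynchronous calls $f=o!m(\bar e)$; each call creates a process on $o$ and a future $f$ that this process resolves with its return value. At most one process at a time has control of an object. It gives control up only by terminating, by `suspend`, or at an `await`. A synchronous call on `this` is executed inside the calling process; a synchronous call on another object is an asynchronous call followed by `get`. The statement $x=f.\mathtt{get}$ keeps control of the object and blocks until $f$ is resolved. The statement $\mathtt{await}\ g$, where $g$ is built from tests $f?$ and Boolean conditions by conjunction, releases the object; the process may take control again when $g$ holds and the object is idle. Creating an object runs its initialization and then starts its method `run`, if it has one. A program consists of classes and a main block; its reachable states are those that can be reached from the initial state, in which only the main block is running. **The class `Mem`.** Its fields are `list` (pending accesses $\mathtt{Write}(t,loc,val,id)$ and $\mathtt{Read}(t,loc,id)$, initially empty), `counter` (initially $0$), `done` (set of identifiers, initially empty), `mem` (map from locations to values) and `ret` (map from identifiers to values, initially empty). Its methods are: - `read(t,loc)`: appends $\mathtt{Read}(t,loc,id)$ to `list`, with $id$ the value of `counter`, increments `counter`, and returns the future of the call `this!internalRead(id)`; - `internalRead(id)`: `await contains(done,id); return lookupUnsafe(ret,id);` - `write(t,loc,val)`: appends $\mathtt{Write}(t,loc,val,id)$,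 with $id$ the value of `counter`, and increments `counter`; - `const(i)`: returns $i$; - `run()`: forever executes `await list != Nil;`, computes by `this.strategy()` the list of positions that may be executed next, chooses a position from it, obtains the access at this position (and, for a read, the value given by `getValueFor`) while removing it from `list` by `this.getAccess(pos)`, adds its identifier to `done`, and stores the value in `mem` for a write and in `ret` for a read; - `strategy()`: returns the positions $i$ such that `maySwap(list[j],list[i])` is true for all $j<i$; - `maySwap(a,b)`: in the core model, true iff $a$ and $b$ are from different threads. In the variants with write-write (write-read) relaxation it is also true if $a$ is a write, $b$ is a write (a read), and their locations differ. In the variants with early reads it is also true if $a$ is a write and $b$ a read at the same location; - `getValueFor(t,loc,pos)`: looks $loc$ up in `mem`; in the variants with early reads it first looks for the last write of $t$ to $loc$ in `list` before position $pos$ and returns its value if there is one. The variant (any combination of the three relaxations), the initial contents of `mem`, and the function choosing a position are arbitrary. **Deadlocks.** In a given state, a process $p$ is *halting* if either it has control of its object and is at a `get` on an unresolved future, or it is at an `await`, has released its object, and cannot continue because the guard does not hold or the object is not idle. A process $p_1$ *depends on* a process $p_2$ if $p_1$ is halting and execution of $p_2$ would allow $p_1$ to continue. That is, some hypothetical execution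 of $p_2$ from this state has a step of $p_2$ that makes $p_1$ able to continue after its `get` or `await`, while $p_1$ could not continue before. As $p_2$ may be halting itself, its surroundings may change during this execution so as to provide what $p_2$ waits for: fields, control of objects, futures and other processes may change arbitrarily, except that $p_1$ and $p_2$ themselves, the classes of objects, the values of resolved futures, the set of existing objects of which $p_2$ has control and the fields of these objects stay the same, as does the truth of the condition (future resolved, or guard satisfied) for which $p_1$ waits. A *deadlock* is a circular dependency between at least two processes: distinct processes $p_0,\dots,p_{k-1}$, $k\ge 2$, such that $p_i$ depends on $p_{i+1 \bmod k}$ for all $i$. **Lemma.** Let $P$ be an ABS program that contains the class `Mem`. No reachable state of $P$ contains a deadlock all of whose processes run on instances of `Mem` (the same instance or different ones). This holds for every such program, whether or not it is well typed. -/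

import Mathlib

namespace ABS

/-! ## Names, values and pure expressions -/

/-- Names of classes, methods, fields, local variables and data constructors.  The names that occur
in the class `Mem` are listed; every other name of a program is some `user n`. -/
inductive Ident
  -- class and methods
  | Mem | run | read | write | const | internalRead | strategy | getAccess
  | maySwap | maySwapVersion (n : ℕ) | getValueFor | getValueForCore
  -- fields
  | list | counter | done | mem | ret
  -- local variables
  | t | loc | val | i | j | myId | accList | pp | id | allowed | add | b | pos | acc | value
  | a | tid | loca | locb | last | result
  -- data constructors
  | Nil | Cons | EmptySet | Insert | EmptyMap | InsertAssoc | Pair | Just | Nothing | Read | Write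
  -- all other names
  | user (n : ℕ)
  deriving DecidableEq

/-- Object identities. -/
abbrev Oid := ℕ

/-- Process identities.  Every asynchronous call creates one process and one future, so a future is
identified by the process that resolves it. -/
abbrev Pid := ℕ

/-- Run-time values: primitive values, references, futures and terms of algebraic data types. -/
inductive Value
  | unit
  | null
  | bool (b : Bool)
  | int (n : ℤ)
  | rat (q : ℚ)
  | str (s : String)
  | obj (o : Oid)
  | fut (p : Pid)
  | data (c : Ident) (args : List Value)

abbrev Store := Ident → Option Value

/-- What an expression of a process may depend on. -/
structure Env where
  self : Oid
  locals : Store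
  fields : Store

/-- Side-effect free expressions.  A function of the functional sublanguage is represented by its
denotation: the set of results it may return on given arguments.  This set is empty where the
function is undefined (a failing `case`, `nth` out of range, …), and it has several elements for
functions such as `random`. -/
inductive Expr
  | lit (v : Value)
  | this
  | var (x : Ident)
  | field (x : Ident)
  | app (f : List Value → Set Value) (args : List Expr)

mutual

/-- The possible values of an expression. -/
def Expr.vals (env : Env) : Expr → Set Value
  | .lit v => {v}
  | .this => {.obj env.self}
  | .var x => {v | env.locals x = some v}
  | .field x => {v | env.fields x = some v}
  | .app f args => {v | ∃ vs ∈ Expr.valsList env args, v ∈ f vs}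

/-- The possible values of a list of expressions. -/
def Expr.valsList (env : Env) : List Expr → Set (List Value)
  | [] => {[]}
  | e :: es => {l | ∃ v ∈ Expr.vals env e, ∃ vs ∈ Expr.valsList env es, l = v :: vs}

end

/-! ## Statements, classes and programs -/

/-- Patterns of `case` branches; `bound x` is an occurrence of a variable that already has a
value. -/
inductive Pattern
  | wild
  | bind (x : Ident)
  | bound (x : Ident)
  | lit (v : Value)
  | con (c : Ident) (ps : List Pattern)

section

open Classical

mutual

/-- Matching a value against a pattern, extending the local variables by the variables bound. -/
noncomputable def Pattern.matches : Pattern → Value → Store → Option Store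
  | .wild, _, σ => some σ
  | .bind x, v, σ => some (Function.update σ x (some v))
  | .bound x, v, σ => if σ x = some v then some σ else none
  | .lit w, v, σ => if w = v then some σ else none
  | .con c ps, v, σ =>
      match v with
      | .data c' vs => if c = c' then Pattern.matchesList ps vs σ else none
      | _ => none

noncomputable def Pattern.matchesList : List Pattern → List Value → Store → Option Store
  | [], [], σ => some σ
  | p :: ps, v :: vs, σ => (Pattern.matches p v σ).bind (Pattern.matchesList ps vs)
  | _, _, _ => none

end

end

/-- Target of an assignment. -/
inductive LVal
  | discard
  | var (x : Ident)
  | field (x : Ident)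

/-- Guards of `await`: `f?`, a Boolean condition, or a conjunction. -/
inductive Guard
  | fut (e : Expr)
  | cond (e : Expr)
  | and (g₁ g₂ : Guard)

/-- Right-hand sides of assignments: a pure expression, `e!m(args)`, `e.m(args)`, `new C(args)` and
`e.get`. -/
inductive Rhs
  | pure (e : Expr)
  | call (e : Expr) (m : Ident) (args : List Expr)
  | sync (e : Expr) (m : Ident) (args : List Expr)
  | new (C : Ident) (args : List Expr)
  | get (e : Expr)

/-- Statements.  `caseOf e p s₁ s₂` is `case e { p => s₁; _ => s₂ }`, further branches are nested in
`s₂`; if no branch is left, `abort` has no transition.  `fetch x q` is the run-time form of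
`x = e.get` once `e` has been evaluated to the future of process `q`. -/
inductive Stmt
  | skip
  | abort
  | seq (s₁ s₂ : Stmt)
  | assign (x : LVal) (r : Rhs)
  | fetch (x : LVal) (q : Pid)
  | await (g : Guard)
  | suspend
  | ite (e : Expr) (s₁ s₂ : Stmt)
  | while (e : Expr) (s : Stmt)
  | caseOf (e : Expr) (p : Pattern) (s₁ s₂ : Stmt)
  | return (e : Expr)

structure Method where
  params : List Ident
  body : Stmt

/-- A class.  Class parameters become fields; `init` consists of the field initializers and the
initialization block. -/
structure ClassDecl where
  params : List Ident
  init : Stmt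
  methods : Ident → Option Method

structure Program where
  classes : Ident → Option ClassDecl
  main : Stmt

/-! ## States -/

/-- An activation record: local variables, the statements still to be executed, and the place where
the caller in the same process stores the returned value. -/
structure Frame where
  locals : Store
  code : List Stmt
  dest : LVal

/-- A process runs on one object; its stack has more than one frame during synchronous calls on
`this`, and no frame once the process has terminated. -/
structure Proc where
  obj : Oid
  frames : List Frame

/-- An object: its class (`none` for the object of the main block), its fields, and the process that
has control of it, if any. -/
structure Obj where
  cls : Option Ident
  fields : Store
  active : Option Pid

/-- A global state: objects, processes, and the values of the resolved futures. -/
structure State where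
  objs : Oid → Option Obj
  procs : Pid → Option Proc
  futs : Pid → Option Value

def State.setObj (s : State) (o : Oid) (ob : Obj) : State :=
  { s with objs := Function.update s.objs o (some ob) }

def State.setProc (s : State) (p : Pid) (pr : Proc) : State :=
  { s with procs := Function.update s.procs p (some pr) }

def State.setFut (s : State) (p : Pid) (v : Value) : State :=
  { s with futs := Function.update s.futs p (some v) }

/-- Bindings of formal to actual parameters. -/
def bindParams : List Ident → List Value → Store
  | x :: xs, v :: vs => Function.update (bindParams xs vs) x (some v)
  | _, _ => fun _ => none

def LVal.putLocal : LVal → Value → Store → Store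
  | .var x, v, σ => Function.update σ x (some v)
  | _, _, σ => σ

def LVal.putField : LVal → Value → Store → Store
  | .field x, v, σ => Function.update σ x (some v)
  | _, _, σ => σ

/-- The guard may be passed. -/
def Guard.Ready (futs : Pid → Option Value) (env : Env) : Guard → Prop
  | .fut e => ∃ q, Value.fut q ∈ e.vals env ∧ (futs q).isSome
  | .cond e => Value.bool true ∈ e.vals env
  | .and g₁ g₂ => g₁.Ready futs env ∧ g₂.Ready futs env

/-! ## Operational semantics -/

/-- Methods of an object of class `C`. -/
def Program.method (P : Program) (C : Option Ident) (m : Ident) : Option Method :=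
  C.bind fun C => (P.classes C).bind fun cd => cd.methods m

/-- The process created by an asynchronous call. -/
def Method.start (md : Method) (o : Oid) (vs : List Value) : Proc :=
  ⟨o, [⟨bindParams md.params vs, [md.body], .discard⟩]⟩

/-- The process that initializes a new object and then, if there is a method `run`, starts it. -/
def ClassDecl.start (cd : ClassDecl) (o : Oid) : Proc :=
  ⟨o, [⟨fun _ => none,
    match cd.methods .run with
    | some _ => [cd.init, .assign .discard (.call .this .run [])]
    | none => [cd.init], .discard⟩]⟩

/-- Sequential steps of the process that has control of object `self`, on the fields of this object
and the stack of the process.  `meth` is the method table of the object. -/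
inductive LocalStep (meth : Ident → Option Method) (self : Oid) :
    Store → List Frame → Store → List Frame → Prop
  | skip {φ σ k d fs} :
      LocalStep meth self φ (⟨σ, .skip :: k, d⟩ :: fs) φ (⟨σ, k, d⟩ :: fs)
  | seq {φ σ s₁ s₂ k d fs} :
      LocalStep meth self φ (⟨σ, .seq s₁ s₂ :: k, d⟩ :: fs) φ (⟨σ, s₁ :: s₂ :: k, d⟩ :: fs)
  | assign {φ σ x e v k d fs} (hv : v ∈ e.vals ⟨self, σ, φ⟩) :
      LocalStep meth self φ (⟨σ, .assign x (.pure e) :: k, d⟩ :: fs)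
        (x.putField v φ) (⟨x.putLocal v σ, k, d⟩ :: fs)
  | iteTrue {φ σ e s₁ s₂ k d fs} (hv : Value.bool true ∈ e.vals ⟨self, σ, φ⟩) :
      LocalStep meth self φ (⟨σ, .ite e s₁ s₂ :: k, d⟩ :: fs) φ (⟨σ, s₁ :: k, d⟩ :: fs)
  | iteFalse {φ σ e s₁ s₂ k d fs} (hv : Value.bool false ∈ e.vals ⟨self, σ, φ⟩) :
      LocalStep meth self φ (⟨σ, .ite e s₁ s₂ :: k, d⟩ :: fs) φ (⟨σ, s₂ :: k, d⟩ :: fs)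
  | whileTrue {φ σ e st k d fs} (hv : Value.bool true ∈ e.vals ⟨self, σ, φ⟩) :
      LocalStep meth self φ (⟨σ, .while e st :: k, d⟩ :: fs)
        φ (⟨σ, st :: .while e st :: k, d⟩ :: fs)
  | whileFalse {φ σ e st k d fs} (hv : Value.bool false ∈ e.vals ⟨self, σ, φ⟩) :
      LocalStep meth self φ (⟨σ, .while e st :: k, d⟩ :: fs) φ (⟨σ, k, d⟩ :: fs)
  | caseMatch {φ σ σ' e p s₁ s₂ v k d fs} (hv : v ∈ e.vals ⟨self, σ, φ⟩)
      (hm : p.matches v σ = some σ') :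
      LocalStep meth self φ (⟨σ, .caseOf e p s₁ s₂ :: k, d⟩ :: fs) φ (⟨σ', s₁ :: k, d⟩ :: fs)
  | caseElse {φ σ e p s₁ s₂ v k d fs} (hv : v ∈ e.vals ⟨self, σ, φ⟩)
      (hm : p.matches v σ = none) :
      LocalStep meth self φ (⟨σ, .caseOf e p s₁ s₂ :: k, d⟩ :: fs) φ (⟨σ, s₂ :: k, d⟩ :: fs)
  | selfCall {φ σ x e m args vs md k d fs} (ho : Value.obj self ∈ e.vals ⟨self, σ, φ⟩)
      (hvs : vs ∈ Expr.valsList ⟨self, σ, φ⟩ args) (hm : meth m = some md)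
      (hl : vs.length = md.params.length) :
      LocalStep meth self φ (⟨σ, .assign x (.sync e m args) :: k, d⟩ :: fs)
        φ (⟨bindParams md.params vs, [md.body], x⟩ :: ⟨σ, k, d⟩ :: fs)
  | ret {φ σ e v k x σ' k' d fs} (hv : v ∈ e.vals ⟨self, σ, φ⟩) :
      LocalStep meth self φ (⟨σ, .return e :: k, x⟩ :: ⟨σ', k', d⟩ :: fs)
        (x.putField v φ) (⟨x.putLocal v σ', k', d⟩ :: fs)
  | retUnit {φ σ x σ' k' d fs} :
      LocalStep meth self φ (⟨σ, [], x⟩ :: ⟨σ', k', d⟩ :: fs)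
        (x.putField .unit φ) (⟨x.putLocal .unit σ', k', d⟩ :: fs)

/-- `Step P p s s'`: process `p` takes one step, which leads from state `s` to state `s'`. -/
inductive Step (P : Program) (p : Pid) : State → State → Prop
  | local {s o ob φ fs fs'}
      (hp : s.procs p = some ⟨o, fs⟩) (ho : s.objs o = some ob) (ha : ob.active = some p)
      (hl : LocalStep (P.method ob.cls) o ob.fields fs φ fs') :
      Step P p s ((s.setObj o { ob with fields := φ }).setProc p ⟨o, fs'⟩)
  /-- `x = e!m(args)` -/
  | call {s o ob σ x e m args k d fs o' ob' md vs q}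
      (hp : s.procs p = some ⟨o, ⟨σ, .assign x (.call e m args) :: k, d⟩ :: fs⟩)
      (ho : s.objs o = some ob) (ha : ob.active = some p)
      (he : Value.obj o' ∈ e.vals ⟨o, σ, ob.fields⟩)
      (hvs : vs ∈ Expr.valsList ⟨o, σ, ob.fields⟩ args)
      (ho' : s.objs o' = some ob') (hm : P.method ob'.cls m = some md)
      (hl : vs.length = md.params.length)
      (hq : s.procs q = none) (hq' : s.futs q = none) :
      Step P p s (((s.setObj o { ob with fields := x.putField (.fut q) ob.fields }).setProc p
        ⟨o, ⟨x.putLocal (.fut q) σ, k, d⟩ :: fs⟩).setProc q (md.start o' vs))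
  /-- `x = e.m(args)` on another object: an asynchronous call followed by `get` -/
  | remoteSync {s o ob σ x e m args k d fs o' ob' md vs q}
      (hp : s.procs p = some ⟨o, ⟨σ, .assign x (.sync e m args) :: k, d⟩ :: fs⟩)
      (ho : s.objs o = some ob) (ha : ob.active = some p)
      (he : Value.obj o' ∈ e.vals ⟨o, σ, ob.fields⟩) (hne : o' ≠ o)
      (hvs : vs ∈ Expr.valsList ⟨o, σ, ob.fields⟩ args)
      (ho' : s.objs o' = some ob') (hm : P.method ob'.cls m = some md)
      (hl : vs.length = md.params.length)
      (hq : s.procs q = none) (hq' : s.futs q = none) :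
      Step P p s ((s.setProc p ⟨o, ⟨σ, .fetch x q :: k, d⟩ :: fs⟩).setProc q (md.start o' vs))
  /-- `x = new C(args)` -/
  | new {s o ob σ x C args k d fs o' cd vs q}
      (hp : s.procs p = some ⟨o, ⟨σ, .assign x (.new C args) :: k, d⟩ :: fs⟩)
      (ho : s.objs o = some ob) (ha : ob.active = some p)
      (hvs : vs ∈ Expr.valsList ⟨o, σ, ob.fields⟩ args)
      (hC : P.classes C = some cd) (hl : vs.length = cd.params.length)
      (ho' : s.objs o' = none) (hq : s.procs q = none) (hq' : s.futs q = none) :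
      Step P p s ((((s.setObj o { ob with fields := x.putField (.obj o') ob.fields }).setProc p
        ⟨o, ⟨x.putLocal (.obj o') σ, k, d⟩ :: fs⟩).setObj o'
          ⟨some C, bindParams cd.params vs, some q⟩).setProc q (cd.start o'))
  /-- `x = e.get`: evaluation of `e` -/
  | get {s o ob σ x e k d fs q}
      (hp : s.procs p = some ⟨o, ⟨σ, .assign x (.get e) :: k, d⟩ :: fs⟩)
      (ho : s.objs o = some ob) (ha : ob.active = some p)
      (he : Value.fut q ∈ e.vals ⟨o, σ, ob.fields⟩) :
      Step P p s (s.setProc p ⟨o, ⟨σ, .fetch x q :: k, d⟩ :: fs⟩)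
  /-- `x = e.get`: reading the resolved future -/
  | fetch {s o ob σ x k d fs q v}
      (hp : s.procs p = some ⟨o, ⟨σ, .fetch x q :: k, d⟩ :: fs⟩)
      (ho : s.objs o = some ob) (ha : ob.active = some p)
      (hv : s.futs q = some v) :
      Step P p s ((s.setObj o { ob with fields := x.putField v ob.fields }).setProc p
        ⟨o, ⟨x.putLocal v σ, k, d⟩ :: fs⟩)
  /-- `suspend` -/
  | suspend {s o ob σ k d fs}
      (hp : s.procs p = some ⟨o, ⟨σ, .suspend :: k, d⟩ :: fs⟩)
      (ho : s.objs o = some ob) (ha : ob.active = some p) :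
      Step P p s ((s.setObj o { ob with active := none }).setProc p ⟨o, ⟨σ, k, d⟩ :: fs⟩)
  /-- `await g` releases control; the process stays at this statement until it is resumed -/
  | release {s o ob σ g k d fs}
      (hp : s.procs p = some ⟨o, ⟨σ, .await g :: k, d⟩ :: fs⟩)
      (ho : s.objs o = some ob) (ha : ob.active = some p) :
      Step P p s (s.setObj o { ob with active := none })
  /-- a process waiting at `await g` takes control of an idle object once `g` holds -/
  | resume {s o ob σ g k d fs}
      (hp : s.procs p = some ⟨o, ⟨σ, .await g :: k, d⟩ :: fs⟩)
      (ho : s.objs o = some ob) (ha : ob.active = none)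
      (hg : g.Ready s.futs ⟨o, σ, ob.fields⟩) :
      Step P p s ((s.setObj o { ob with active := some p }).setProc p ⟨o, ⟨σ, k, d⟩ :: fs⟩)
  /-- any other unfinished process may take control of an idle object -/
  | activate {s o ob σ k d fs}
      (hp : s.procs p = some ⟨o, ⟨σ, k, d⟩ :: fs⟩)
      (hk : ∀ g k', k ≠ .await g :: k')
      (ho : s.objs o = some ob) (ha : ob.active = none) :
      Step P p s (s.setObj o { ob with active := some p })
  /-- termination by `return e` -/
  | finish {s o ob σ e v k d}
      (hp : s.procs p = some ⟨o, [⟨σ, .return e :: k, d⟩]⟩)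
      (ho : s.objs o = some ob) (ha : ob.active = some p)
      (hv : v ∈ e.vals ⟨o, σ, ob.fields⟩) :
      Step P p s (((s.setObj o { ob with active := none }).setProc p ⟨o, []⟩).setFut p v)
  /-- termination at the end of a body without `return` -/
  | finishUnit {s o ob σ d}
      (hp : s.procs p = some ⟨o, [⟨σ, [], d⟩]⟩)
      (ho : s.objs o = some ob) (ha : ob.active = some p) :
      Step P p s (((s.setObj o { ob with active := none }).setProc p ⟨o, []⟩).setFut p .unit)

/-- Initially there is one object without a class, on which the main block runs. -/
def Program.initial (P : Program) : State where
  objs := Function.update (fun _ => none) 0 (some ⟨none, fun _ => none, some 0⟩)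
  procs := Function.update (fun _ => none) 0
    (some ⟨0, [⟨fun _ => none, [P.main], .discard⟩]⟩)
  futs := fun _ => none

/-- States that some execution of the program reaches. -/
def Reachable (P : Program) (s : State) : Prop :=
  Relation.ReflTransGen (fun s s' => ∃ p, Step P p s s') P.initial s

/-! ## Deadlocks -/

/-- The next statement of `p` is `get` on the future of `q`. -/
def State.NextGet (s : State) (p q : Pid) : Prop :=
  ∃ o σ x k d fs, s.procs p = some ⟨o, ⟨σ, .fetch x q :: k, d⟩ :: fs⟩

/-- The next statement of `p`, on an object that is in state `ob`, is `await g`, to be evaluated in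
the environment `env`. -/
def State.NextAwait (s : State) (p : Pid) (ob : Obj) (g : Guard) (env : Env) : Prop :=
  ∃ o σ k d fs, s.procs p = some ⟨o, ⟨σ, .await g :: k, d⟩ :: fs⟩ ∧
    s.objs o = some ob ∧ env = ⟨o, σ, ob.fields⟩

/-- `p` has control of its object. -/
def State.Holds (s : State) (p : Pid) : Prop :=
  ∃ pr ob, s.procs p = some pr ∧ s.objs pr.obj = some ob ∧ ob.active = some p

/-- The condition for which `p` waits at its `get` or `await` statement is satisfied. -/
def State.CondHolds (s : State) (p : Pid) : Prop :=
  (∃ q, s.NextGet p q ∧ (s.futs q).isSome) ∨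
  (∃ ob g env, s.NextAwait p ob g env ∧ g.Ready s.futs env)

/-- `p` may continue after its `get` or `await` statement: at a `get` the future is resolved, at an
`await` the guard holds and the object is idle. -/
def State.MayContinue (s : State) (p : Pid) : Prop :=
  (∃ q, s.NextGet p q ∧ (s.futs q).isSome) ∨
  (∃ ob g env, s.NextAwait p ob g env ∧ g.Ready s.futs env ∧ ob.active = none)

/-- `p` halts at a `get` statement, blocking its object, or at an `await` statement, where it has
released its object, and cannot continue. -/
def State.Halting (s : State) (p : Pid) : Prop :=
  ((∃ q, s.NextGet p q ∧ s.Holds p) ∨ (∃ ob g env, s.NextAwait p ob g env ∧ ¬ s.Holds p)) ∧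
    ¬ s.MayContinue p

/-- A hypothetical change of the state around `p₁` and `p₂`, by which whatever `p₂` waits for may be
provided: fields, control of objects, futures and other processes may change arbitrarily, but not
the processes `p₁` and `p₂` themselves, nor which objects `p₂` has control of, nor the fields of these
objects.  Classes of objects and values of resolved futures persist.  The change does not affect
whether the condition for which `p₁` waits is satisfied. -/
structure Interference (p₁ p₂ : Pid) (s s' : State) : Prop where
  proc_left : s'.procs p₁ = s.procs p₁
  proc_right : s'.procs p₂ = s.procs p₂
  futs : ∀ q v, s.futs q = some v → s'.futs q = some v
  objs : ∀ o ob, s.objs o = some ob → ∃ ob', s'.objs o = some ob' ∧ ob'.cls = ob.cls ∧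
    (ob'.active = some p₂ ↔ ob.active = some p₂) ∧ (ob.active = some p₂ → ob'.fields = ob.fields)
  cond : s'.CondHolds p₁ ↔ s.CondHolds p₁

/-- Hypothetical executions of `p₂`, interleaved with changes of its surroundings, during which `p₁`
is never able to continue (after the first state). -/
inductive Execution (P : Program) (p₁ p₂ : Pid) : State → State → Prop
  | refl (s) : Execution P p₁ p₂ s s
  | step {s t u} : Execution P p₁ p₂ s t → Step P p₂ t u → ¬ u.MayContinue p₁ →
      Execution P p₁ p₂ s u
  | change {s t u} : Execution P p₁ p₂ s t → Interference p₁ p₂ t u → ¬ u.MayContinue p₁ →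
      Execution P p₁ p₂ s u

/-- In state `s`, process `p₁` depends on `p₂`: it halts at a `get` or `await` statement, and
execution of `p₂` would allow it to continue.  As `p₂` may itself be halting, its execution is
hypothetical; the step that makes `p₁` able to continue is a step of `p₂`. -/
def DependsOn (P : Program) (s : State) (p₁ p₂ : Pid) : Prop :=
  s.Halting p₁ ∧ ∃ t u, Execution P p₁ p₂ s t ∧ Step P p₂ t u ∧ u.MayContinue p₁

/-- A deadlock: a circular dependency between at least two processes (the successor of the last
index of `Fin (n + 2)` is `0`). -/
def IsDeadlock (P : Program) (s : State) {n : ℕ} (c : Fin (n + 2) → Pid) : Prop :=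
  Function.Injective c ∧ ∀ i, DependsOn P s (c i) (c (i + 1))

/-- `p` is a process on an instance of class `C`. -/
def State.RunsOn (s : State) (p : Pid) (C : Ident) : Prop :=
  ∃ pr ob, s.procs p = some pr ∧ s.objs pr.obj = some ob ∧ ob.cls = some C

/-! ## Library functions -/

/-- Elements of a term `cons(x₁, cons(x₂, … nil))`. -/
def Value.elems (nil cons : Ident) : Value → Option (List Value)
  | .data c [] => if c = nil then some [] else none
  | .data c [x, l] => if c = cons then (l.elems nil cons).map (x :: ·) else none
  | _ => none

def Value.ofElems (nil cons : Ident) : List Value → Value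
  | [] => .data nil []
  | x :: l => .data cons [x, Value.ofElems nil cons l]

/-- Lists, sets and maps are algebraic data types; a map is a list of pairs. -/
def Value.toList : Value → Option (List Value) := Value.elems .Nil .Cons
def Value.ofList : List Value → Value := Value.ofElems .Nil .Cons
def Value.toSet : Value → Option (List Value) := Value.elems .EmptySet .Insert
def Value.toMap : Value → Option (List Value) := Value.elems .EmptyMap .InsertAssoc

/-- Denotation of a partial function on values. -/
def fn1 (f : Value → Option Value) : List Value → Set Value
  | [x] => {v | f x = some v}
  | _ => ∅

def fn2 (f : Value → Value → Option Value) : List Value → Set Value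
  | [x, y] => {v | f x y = some v}
  | _ => ∅

def fn3 (f : Value → Value → Value → Option Value) : List Value → Set Value
  | [x, y, z] => {v | f x y z = some v}
  | _ => ∅

/-- Application of a data constructor. -/
def con (c : Ident) (args : List Expr) : Expr := .app (fun vs => {.data c vs}) args

noncomputable section

open Classical

def eq (e₁ e₂ : Expr) : Expr := .app (fn2 fun x y => some (.bool (decide (x = y)))) [e₁, e₂]

def ne (e₁ e₂ : Expr) : Expr := .app (fn2 fun x y => some (.bool (decide (x ≠ y)))) [e₁, e₂]

def not (e : Expr) : Expr :=
  .app (fn1 fun | .bool x => some (.bool (!x)) | _ => none) [e]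

def or (e₁ e₂ : Expr) : Expr :=
  .app (fn2 fun | .bool x, .bool y => some (.bool (x || y)) | _, _ => none) [e₁, e₂]

def lt (e₁ e₂ : Expr) : Expr :=
  .app (fn2 fun | .int x, .int y => some (.bool (decide (x < y))) | _, _ => none) [e₁, e₂]

def plus (e₁ e₂ : Expr) : Expr :=
  .app (fn2 fun | .int x, .int y => some (.int (x + y)) | _, _ => none) [e₁, e₂]

def minus (e₁ e₂ : Expr) : Expr :=
  .app (fn2 fun | .int x, .int y => some (.int (x - y)) | _, _ => none) [e₁, e₂]

def int (n : ℤ) : Expr := .lit (.int n)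

def length (e : Expr) : Expr := .app (fn1 fun l => l.toList.map fun l => .int l.length) [e]

def appendright (e₁ e₂ : Expr) : Expr :=
  .app (fn2 fun l x => l.toList.map fun l => Value.ofList (l ++ [x])) [e₁, e₂]

def nth (e₁ e₂ : Expr) : Expr :=
  .app (fn2 fun
    | l, .int n => l.toList.bind fun l => if 0 ≤ n then l[n.toNat]? else none
    | _, _ => none) [e₁, e₂]

/-- The list without the element at the given position. -/
def removeAt (e₁ e₂ : Expr) : Expr :=
  .app (fn2 fun
    | l, .int n => l.toList.map fun l => Value.ofList (if 0 ≤ n then l.eraseIdx n.toNat else l)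
    | _, _ => none) [e₁, e₂]

/-- The elements at the positions from `e₂` to `e₃`. -/
def slice (e₁ e₂ e₃ : Expr) : Expr :=
  .app (fn3 fun
    | l, .int m, .int n => l.toList.map fun l =>
        Value.ofList ((l.take (n + 1).toNat).drop m.toNat)
    | _, _, _ => none) [e₁, e₂, e₃]

def contains (e₁ e₂ : Expr) : Expr :=
  .app (fn2 fun s x => s.toSet.map fun s => .bool (decide (x ∈ s))) [e₁, e₂]

def insertElement (e₁ e₂ : Expr) : Expr :=
  .app (fn2 fun s x => s.toSet.map fun l => if x ∈ l then s else .data .Insert [x, s]) [e₁, e₂]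

/-- A later `put` shadows the earlier ones. -/
def put (e₁ e₂ e₃ : Expr) : Expr :=
  .app (fn3 fun m x y => some (.data .InsertAssoc [.data .Pair [x, y], m])) [e₁, e₂, e₃]

def lookupUnsafe (e₁ e₂ : Expr) : Expr :=
  .app (fn2 fun m x => m.toMap.bind fun m => m.findSome? fun
    | .data .Pair [k, v] => if k = x then some v else none
    | _ => none) [e₁, e₂]

def fst (e : Expr) : Expr := .app (fn1 fun | .data .Pair [x, _] => some x | _ => none) [e]

def snd (e : Expr) : Expr := .app (fn1 fun | .data .Pair [_, y] => some y | _ => none) [e]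

/-- The thread of an access `Write(tid, loc, value, id)` or `Read(tid, loc, id)`. -/
def tidOf (e : Expr) : Expr :=
  .app (fn1 fun
    | .data .Write [t, _, _, _] => some t
    | .data .Read [t, _, _] => some t
    | _ => none) [e]

/-- The value of the last write access of thread `e₃` to location `e₂` in the list `e₁`, if any. -/
def getWriteValueFor (e₁ e₂ e₃ : Expr) : Expr :=
  .app (fn3 fun l x t => l.toList.map fun l =>
    match l.reverse.findSome? (fun
      | .data .Write [t', x', v, _] => if t' = t ∧ x' = x then some v else none
      | _ => none) with
    | some v => .data .Just [v]
    | none => .data .Nothing []) [e₁, e₂, e₃]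

/-! ## The class `Mem` -/

def block : List Stmt → Stmt
  | [] => .skip
  | [s] => s
  | s :: l => .seq s (block l)

/-- `x = e` for a local variable and for a field, and `x = this.m(args)`. -/
def setVar (x : Ident) (e : Expr) : Stmt := .assign (.var x) (.pure e)
def setField (x : Ident) (e : Expr) : Stmt := .assign (.field x) (.pure e)
def callThis (x m : Ident) (args : List Expr) : Stmt := .assign (.var x) (.sync .this m args)

/-- `foreach (x < e) { s }` -/
def foreach (x : Ident) (e : Expr) (s : Stmt) : Stmt :=
  block [setVar x (int 0), .while (lt (.var x) e) (block [s, setVar x (plus (.var x) (int 1))])]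

/-- A product of the product line, together with what the model leaves open: the initial contents of
the memory and the function by which the next position is chosen from the list of allowed
positions. -/
structure MemConfig where
  wwFeature : Bool
  wrFeature : Bool
  readEarlyFeature : Bool
  initialMem : Value
  nextPos : List Value → Set Value

namespace Mem

def read : Method where
  params := [.t, .loc]
  body := block [
    setVar .myId (.field .counter),
    setField .list (appendright (.field .list) (con .Read [.var .t, .var .loc, .var .myId])),
    setField .counter (plus (.field .counter) (int 1)),
    .assign (.var .result) (.call .this .internalRead [.var .myId]),
    .return (.var .result)]

def internalRead : Method where
  params := [.myId]
  body := block [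
    .await (.cond (contains (.field .done) (.var .myId))),
    .return (lookupUnsafe (.field .ret) (.var .myId))]

def write : Method where
  params := [.t, .loc, .val]
  body := block [
    setVar .myId (.field .counter),
    setField .list
      (appendright (.field .list) (con .Write [.var .t, .var .loc, .var .val, .var .myId])),
    setField .counter (plus (.field .counter) (int 1))]

def const : Method where
  params := [.i]
  body := .return (.var .i)

def run (cfg : MemConfig) : Method where
  params := []
  body := .while (.lit (.bool true)) (block [
    .await (.cond (ne (.field .list) (con .Nil []))),
    callThis .accList .strategy [],
    callThis .pp .getAccess [.app cfg.nextPos [.var .accList]],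
    .caseOf (fst (.var .pp)) (.con .Write [.bind .t, .bind .loc, .bind .val, .bind .id])
      (block [
        setField .done (insertElement (.field .done) (.var .id)),
        setField .mem (put (.field .mem) (.var .loc) (.var .val))])
    (.caseOf (fst (.var .pp)) (.con .Read [.bind .t, .bind .loc, .bind .id])
      (block [
        setField .done (insertElement (.field .done) (.var .id)),
        setField .ret (put (.field .ret) (.var .id) (snd (.var .pp)))])
      .abort)])

def strategy : Method where
  params := []
  body := block [
    setVar .allowed (con .Nil []),
    foreach .i (length (.field .list)) (block [
      setVar .add (.lit (.bool true)),
      foreach .j (.var .i) (block [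
        callThis .b .maySwap [nth (.field .list) (.var .j), nth (.field .list) (.var .i)],
        .ite (not (.var .b)) (setVar .add (.lit (.bool false))) .skip]),
      .ite (.var .add) (setVar .allowed (con .Cons [.var .i, .var .allowed])) .skip]),
    .return (.var .allowed)]

/-- Gets the access at the given position, with the value read if it is a read access, and removes it
from the list. -/
def getAccess : Method where
  params := [.pos]
  body := block [
    setVar .acc (nth (.field .list) (.var .pos)),
    setVar .value (int 0),
    .caseOf (.var .acc) (.con .Read [.bind .t, .bind .loc, .wild])
      (callThis .value .getValueFor [.var .t, .var .loc, .var .pos])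
      .skip,
    setField .list (removeAt (.field .list) (.var .pos)),
    .return (con .Pair [.var .acc, .var .value])]

def getValueForCore : Method where
  params := [.tid, .loc, .pos]
  body := .return (lookupUnsafe (.field .mem) (.var .loc))

/-- The delta that allows a thread to read its own writes early. -/
def getValueForReadEarly : Method where
  params := [.tid, .loc, .pos]
  body := .caseOf
    (getWriteValueFor (slice (.field .list) (int 0) (minus (.var .pos) (int 1)))
      (.var .loc) (.var .tid)) (.con .Just [.bind .val])
    (.return (.var .val))
    (block [
      callThis .result .getValueForCore [.var .tid, .var .loc, .var .pos],
      .return (.var .result)])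

def maySwapCore : Method where
  params := [.a, .b]
  body := .return (ne (tidOf (.var .a)) (tidOf (.var .b)))

/-- Deltas of `maySwap` take the name of the original method.  This one has the cases
`a = Write(_, loca, _, _)`, `b = Read(_, locb, _)` (first statement) and
`a = Write(_, loca, _, _)`, `b = Write(_, locb, _, _)` (second statement), and calls the original
method in all other cases. -/
def maySwapDelta (original : Ident) (writeRead writeWrite : Stmt) : Method where
  params := [.a, .b]
  body := block [
    setVar .ret (.lit (.bool false)),
    .caseOf (.var .a) (.con .Read [.wild, .wild, .wild])
      (callThis .ret original [.var .a, .var .b])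
    (.caseOf (.var .a) (.con .Write [.wild, .bind .loca, .wild, .wild])
      (.caseOf (.var .b) (.con .Read [.wild, .bind .locb, .wild])
        writeRead
      (.caseOf (.var .b) (.con .Write [.wild, .bind .locb, .wild, .wild])
        writeWrite
        .abort))
      .abort),
    .return (.var .ret)]

def callOriginal (original : Ident) : Stmt := callThis .ret original [.var .a, .var .b]

/-- Swapping is also allowed for accesses to different locations. -/
def orDifferent (original : Ident) : Stmt :=
  block [
    callThis .last original [.var .a, .var .b],
    setVar .ret (or (.var .last) (ne (.var .loca) (.var .locb)))]

/-- Swapping is also allowed for accesses to the same location. -/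
def orSame (original : Ident) : Stmt :=
  .ite (eq (.var .loca) (.var .locb)) (setVar .ret (.lit (.bool true))) (callOriginal original)

def wrDelta (original : Ident) : Method :=
  maySwapDelta original (orDifferent original) (callOriginal original)

def wrOwnDelta (original : Ident) : Method :=
  maySwapDelta original (orSame original) (callOriginal original)

def wwDelta (original : Ident) : Method :=
  maySwapDelta original (callOriginal original) (orDifferent original)

/-- The deltas of `maySwap` in a product, in the order of their application. -/
def deltas (cfg : MemConfig) : List (Ident → Method) :=
  (if cfg.wwFeature then [wwDelta] else []) ++
  (if cfg.readEarlyFeature then [wrOwnDelta] else []) ++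
  (if cfg.wrFeature then [wrDelta] else [])

/-- The method `maySwap` after the application of the first `n` deltas; the previous versions are
kept under the names `maySwapVersion n`. -/
def maySwap (cfg : MemConfig) : ℕ → Option Method
  | 0 => some maySwapCore
  | n + 1 => (deltas cfg)[n]?.map fun delta => delta (.maySwapVersion n)

def methods (cfg : MemConfig) : Ident → Option Method
  | .run => some (run cfg)
  | .read => some read
  | .internalRead => some internalRead
  | .write => some write
  | .const => some const
  | .strategy => some strategy
  | .getAccess => some getAccess
  | .getValueForCore => some getValueForCore
  | .getValueFor => some (if cfg.readEarlyFeature then getValueForReadEarly else getValueForCore)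
  | .maySwapVersion n => maySwap cfg n
  | .maySwap => maySwap cfg (deltas cfg).length
  | _ => none

end Mem

/-- The class `Mem`. -/
def memClass (cfg : MemConfig) : ClassDecl where
  params := []
  init := block [
    setField .list (con .Nil []),
    setField .counter (int 0),
    setField .done (con .EmptySet []),
    setField .mem (.lit cfg.initialMem),
    setField .ret (con .EmptyMap [])]
  methods := Mem.methods cfg

end

end ABS

/-!
On an instance of `Mem` a process can halt only at the guard `list != Nil` of `run` or at the
guard `contains(done, id)` of `internalRead`: there is no `get`, and `internalRead` is never
called synchronously. Neither guard tests a future, so it can become true only by a change of the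
fields of the object, and every dependency is between processes on the same object. A process
waiting in `internalRead` changes no field after its guard, hence no process depends on it. So in
a chain of two dependencies between halting processes the last two processes both wait in `run`,
for the same condition on the same fields. But whenever one of them could be resumed, so could the
other, so no step of the one is what enables the other.
-/

namespace ABS

/-! ## Processes waiting at a guard -/

/-- The next statement of the process is `await g`, to be evaluated with local variables `σ`. -/
def Proc.Awaits (pr : Proc) (g : Guard) (σ : Store) : Prop :=
  ∃ k d fs, pr.frames = ⟨σ, .await g :: k, d⟩ :: fs

/-- The guard contains no test `f?`, or at least its truth does not depend on any. -/
def Guard.IgnoresFutures (g : Guard) : Prop :=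
  ∀ futs futs' env, g.Ready futs env ↔ g.Ready futs' env

theorem Guard.ignoresFutures_cond (e : Expr) : (Guard.cond e).IgnoresFutures :=
  fun _ _ _ => Iff.rfl

theorem State.MayContinue.condHolds {s : State} {p : Pid} (h : s.MayContinue p) :
    s.CondHolds p :=
  h.imp_right fun ⟨ob, g, env, hnext, hready, _⟩ => ⟨ob, g, env, hnext, hready⟩

section Awaits

variable {s t : State} {p : Pid} {pr : Proc} {g : Guard} {σ : Store} {ob ob' : Obj}

theorem Proc.Awaits.not_nextGet (hw : pr.Awaits g σ) (hp : s.procs p = some pr) (q : Pid) :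
    ¬ s.NextGet p q := by
  rintro ⟨o, τ, x, k, d, fs, hq⟩
  obtain ⟨k', d', fs', hfs⟩ := hw
  obtain rfl := Option.some.inj (hp.symm.trans hq)
  simp at hfs

theorem Proc.Awaits.nextAwait_iff (hw : pr.Awaits g σ) (hp : s.procs p = some pr)
    (ho : s.objs pr.obj = some ob) {g' : Guard} {env : Env} :
    s.NextAwait p ob' g' env ↔ ob' = ob ∧ g' = g ∧ env = ⟨pr.obj, σ, ob.fields⟩ := by
  obtain ⟨o, frames⟩ := pr
  obtain ⟨k, d, fs, rfl⟩ := hw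
  constructor
  · rintro ⟨o', σ', k', d', fs', hp', ho', rfl⟩
    cases hp.symm.trans hp'
    cases ho.symm.trans ho'
    exact ⟨rfl, rfl, rfl⟩
  · rintro ⟨rfl, rfl, rfl⟩
    exact ⟨o, σ, k, d, fs, hp, ho, rfl⟩

theorem Proc.Awaits.condHolds_iff (hw : pr.Awaits g σ) (hp : s.procs p = some pr)
    (ho : s.objs pr.obj = some ob) :
    s.CondHolds p ↔ g.Ready s.futs ⟨pr.obj, σ, ob.fields⟩ := by
  simp [State.CondHolds, hw.not_nextGet hp, hw.nextAwait_iff hp ho]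

theorem Proc.Awaits.mayContinue_iff (hw : pr.Awaits g σ) (hp : s.procs p = some pr)
    (ho : s.objs pr.obj = some ob) :
    s.MayContinue p ↔ s.CondHolds p ∧ ob.active = none := by
  simp [State.MayContinue, hw.condHolds_iff hp ho, hw.not_nextGet hp, hw.nextAwait_iff hp ho]

theorem Proc.Awaits.condHolds_congr (hw : pr.Awaits g σ) (hg : g.IgnoresFutures)
    (hp : s.procs p = some pr) (hp' : t.procs p = some pr) (ho : s.objs pr.obj = some ob)
    (ho' : t.objs pr.obj = some ob') (hfields : ob'.fields = ob.fields) :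
    t.CondHolds p ↔ s.CondHolds p := by
  rw [hw.condHolds_iff hp' ho', hw.condHolds_iff hp ho, hfields]
  exact hg _ _ _

end Awaits

/-! ## The effect of a step -/

section Step

variable {P : Program} {p q : Pid} {s s' : State} {pr : Proc} {o : Oid} {ob : Obj}

theorem Step.procs_of_ne (h : Step P p s s') (hqp : q ≠ p) (hq : s.procs q = some pr) :
    s'.procs q = some pr := by
  cases h <;> simp only [State.setObj, State.setProc, State.setFut, Function.update_apply] <;> grind

theorem Step.exists_procs_eq {fs : List Frame} (h : Step P p s s')
    (hp : s.procs p = some ⟨o, fs⟩) : ∃ fs', s'.procs p = some ⟨o, fs'⟩ := by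
  cases h <;> simp only [State.setObj, State.setProc, State.setFut, Function.update_apply] <;> grind

theorem Step.objs_of_ne {o' : Oid} {fs : List Frame} (h : Step P p s s')
    (hp : s.procs p = some ⟨o, fs⟩) (hne : o' ≠ o) (ho' : s.objs o' = some ob) :
    s'.objs o' = some ob := by
  cases h <;> simp only [State.setObj, State.setProc, State.setFut, Function.update_apply] <;> grind

theorem Step.eq_resume_of_await {σ : Store} {g : Guard} {k : List Stmt} {d : LVal}
    {fs : List Frame} (h : Step P p s s')
    (hp : s.procs p = some ⟨o, ⟨σ, .await g :: k, d⟩ :: fs⟩) (ho : s.objs o = some ob)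
    (ha : ob.active ≠ some p) :
    g.Ready s.futs ⟨o, σ, ob.fields⟩ ∧ ob.active = none ∧
      s' = (s.setObj o { ob with active := some p }).setProc p ⟨o, ⟨σ, k, d⟩ :: fs⟩ := by
  cases h with
  | resume hp' ho' ha' hg =>
    cases hp.symm.trans hp'
    cases ho.symm.trans ho'
    exact ⟨hg, ha', rfl⟩
  | _ => simp_all

/-- Stacks of processes that terminate, or have terminated, without any further effect on the
fields of their object. -/
def Returning (fs : List Frame) : Prop :=
  fs = [] ∨ ∃ σ e k d, fs = [⟨σ, .return e :: k, d⟩]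

theorem Returning.not_localStep {meth : Ident → Option Method} {φ φ' : Store}
    {fs fs' : List Frame} (h : Returning fs) : ¬ LocalStep meth o φ fs φ' fs' := by
  obtain rfl | ⟨σ, e, k, d, rfl⟩ := h <;> nofun

theorem Step.returning {fs : List Frame} (h : Step P p s s') (hp : s.procs p = some ⟨o, fs⟩)
    (hfs : Returning fs) (ho : s.objs o = some ob) :
    (∃ ob', s'.objs o = some ob' ∧ ob'.fields = ob.fields) ∧
      ∃ fs', s'.procs p = some ⟨o, fs'⟩ ∧ Returning fs' := by
  have hlocal := @hfs.not_localStep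
  obtain rfl | ⟨σ, e, k, d, rfl⟩ := hfs <;>
    cases h <;> simp only [State.setObj, State.setProc, State.setFut, Function.update_apply] <;>
      grind [Returning]

theorem Step.returning_of_await {σ : Store} {g : Guard} {e : Expr} {k : List Stmt} {d : LVal}
    (h : Step P p s s') (hp : s.procs p = some ⟨o, [⟨σ, .await g :: .return e :: k, d⟩]⟩)
    (ho : s.objs o = some ob) (ha : ob.active ≠ some p) :
    ob.active = none ∧ (∃ ob', s'.objs o = some ob' ∧ ob'.fields = ob.fields) ∧
      ∃ fs', s'.procs p = some ⟨o, fs'⟩ ∧ Returning fs' := by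
  obtain ⟨-, hidle, rfl⟩ := h.eq_resume_of_await hp ho ha
  exact ⟨hidle, ⟨{ ob with active := some p }, by simp [State.setObj, State.setProc], rfl⟩,
    [⟨σ, .return e :: k, d⟩], by simp [State.setProc], .inr ⟨σ, e, k, d, rfl⟩⟩

end Step

/-! ## Dependencies of a process waiting at a guard -/

section Dependencies

variable {P : Program} {s t : State} {p₁ p₂ : Pid}

theorem Execution.not_mayContinue (h : Execution P p₁ p₂ s t) (hs : ¬ s.MayContinue p₁) :
    ¬ t.MayContinue p₁ := by
  cases h <;> assumption

theorem Execution.invariant {I : State → Prop} (h : Execution P p₁ p₂ s t)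
    (hs : ¬ s.MayContinue p₁) (hinit : I s)
    (hchange : ∀ ⦃t u⦄, I t → Interference p₁ p₂ t u → I u)
    (hstep : ∀ ⦃t u⦄, I t → ¬ t.MayContinue p₁ → Step P p₂ t u → I u) : I t := by
  induction h with
  | refl => exact hinit
  | step hexec hst _ ih => exact hstep ih (hexec.not_mayContinue hs) hst
  | change _ hi _ ih => exact hchange ih hi

theorem not_dependsOn_of_invariant (I : State → Prop) (hinit : I s)
    (hchange : ∀ ⦃t u⦄, I t → Interference p₁ p₂ t u → I u)
    (hstep : ∀ ⦃t u⦄, I t → ¬ t.MayContinue p₁ → Step P p₂ t u → I u ∧ ¬ u.MayContinue p₁) :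
    ¬ DependsOn P s p₁ p₂ := by
  rintro ⟨⟨-, hs⟩, t, u, hexec, hlast, hu⟩
  have ht : I t := hexec.invariant hs hinit hchange fun _ _ h hm hst => (hstep h hm hst).1
  exact (hstep ht (hexec.not_mayContinue hs) hlast).2 hu

variable {pr₁ pr₂ : Proc} {ob : Obj} {g₁ g₂ : Guard} {σ₁ σ₂ : Store}

theorem DependsOn.obj_eq (h : DependsOn P s p₁ p₂) (hp₁ : s.procs p₁ = some pr₁)
    (hw₁ : pr₁.Awaits g₁ σ₁) (hg₁ : g₁.IgnoresFutures) (ho : s.objs pr₁.obj = some ob)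
    (hp₂ : s.procs p₂ = some pr₂) : pr₁.obj = pr₂.obj := by
  by_contra hobj
  have hne : p₁ ≠ p₂ := by
    rintro rfl
    exact hobj (congrArg Proc.obj (Option.some.inj (hp₁.symm.trans hp₂)))
  refine not_dependsOn_of_invariant
    (fun t => t.procs p₁ = some pr₁ ∧ (∃ ob, t.objs pr₁.obj = some ob) ∧
      ∃ fs, t.procs p₂ = some ⟨pr₂.obj, fs⟩)
    ⟨hp₁, ⟨ob, ho⟩, pr₂.frames, hp₂⟩ ?_ ?_ h
  · rintro t u ⟨ht₁, ⟨ob, ho⟩, fs, ht₂⟩ hi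
    obtain ⟨ob', ho', -⟩ := hi.objs _ _ ho
    exact ⟨hi.proc_left.trans ht₁, ⟨ob', ho'⟩, fs, hi.proc_right.trans ht₂⟩
  · rintro t u ⟨ht₁, ⟨ob, ho⟩, fs, ht₂⟩ hm hst
    have hu₁ := hst.procs_of_ne hne ht₁
    have ho' := hst.objs_of_ne ht₂ hobj ho
    rw [hw₁.mayContinue_iff ht₁ ho] at hm
    rw [hw₁.mayContinue_iff hu₁ ho', hw₁.condHolds_congr hg₁ ht₁ hu₁ ho ho' rfl]
    exact ⟨⟨hu₁, ⟨ob, ho'⟩, hst.exists_procs_eq ht₂⟩, hm⟩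

theorem not_dependsOn_of_ready_imp (hp₁ : s.procs p₁ = some pr₁) (hw₁ : pr₁.Awaits g₁ σ₁)
    (hp₂ : s.procs p₂ = some pr₂) (hw₂ : pr₂.Awaits g₂ σ₂) (hobj : pr₁.obj = pr₂.obj)
    (ho : s.objs pr₂.obj = some ob) (ha : ob.active ≠ some p₂)
    (himp : ∀ futs φ, g₂.Ready futs ⟨pr₂.obj, σ₂, φ⟩ → g₁.Ready futs ⟨pr₂.obj, σ₁, φ⟩) :
    ¬ DependsOn P s p₁ p₂ := by
  obtain ⟨o, frames⟩ := pr₂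
  obtain ⟨k, d, fs, rfl⟩ := hw₂
  obtain rfl : pr₁.obj = o := hobj
  refine not_dependsOn_of_invariant
    (fun t => t.procs p₁ = some pr₁ ∧
      t.procs p₂ = some ⟨pr₁.obj, ⟨σ₂, .await g₂ :: k, d⟩ :: fs⟩ ∧
      ∃ ob, t.objs pr₁.obj = some ob ∧ ob.active ≠ some p₂)
    ⟨hp₁, hp₂, ob, ho, ha⟩ ?_ ?_
  · rintro t u ⟨ht₁, ht₂, ob, ho, ha⟩ hi
    obtain ⟨ob', ho', -, hact, -⟩ := hi.objs _ _ ho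
    exact ⟨hi.proc_left.trans ht₁, hi.proc_right.trans ht₂, ob', ho', hact.not.2 ha⟩
  · rintro t u ⟨ht₁, ht₂, ob, ho, ha⟩ hm hst
    obtain ⟨hready, hidle, -⟩ := hst.eq_resume_of_await ht₂ ho ha
    rw [hw₁.mayContinue_iff ht₁ ho, hw₁.condHolds_iff ht₁ ho] at hm
    exact absurd ⟨himp _ _ hready, hidle⟩ hm

/-- The process is at an `await`, after which it terminates by the `return` that follows. -/
def Proc.AwaitsThenReturns (pr : Proc) : Prop :=
  ∃ σ g e k d, pr.frames = [⟨σ, .await g :: .return e :: k, d⟩]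

theorem not_dependsOn_of_awaitsThenReturns (hp₁ : s.procs p₁ = some pr₁)
    (hw₁ : pr₁.Awaits g₁ σ₁) (hg₁ : g₁.IgnoresFutures) (ho₁ : ∃ ob, s.objs pr₁.obj = some ob)
    (hp₂ : s.procs p₂ = some pr₂) (hret₂ : pr₂.AwaitsThenReturns)
    (ho₂ : s.objs pr₂.obj = some ob) (ha : ob.active ≠ some p₂) : ¬ DependsOn P s p₁ p₂ := by
  intro hdep
  have hobj : pr₁.obj = pr₂.obj := hdep.obj_eq hp₁ hw₁ hg₁ ho₁.choose_spec hp₂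
  have hne : p₁ ≠ p₂ := by
    rintro rfl
    cases hp₁.symm.trans hp₂
    exact not_dependsOn_of_ready_imp hp₁ hw₁ hp₁ hw₁ rfl ho₂ ha (fun _ _ h => h) hdep
  obtain ⟨o, frames⟩ := pr₂
  obtain ⟨σ₂, g₂, e, k, d, rfl⟩ := hret₂
  obtain rfl : pr₁.obj = o := hobj
  refine not_dependsOn_of_invariant
    (fun t => t.procs p₁ = some pr₁ ∧ ∃ ob, t.objs pr₁.obj = some ob ∧
      ((t.procs p₂ = some ⟨pr₁.obj, [⟨σ₂, .await g₂ :: .return e :: k, d⟩]⟩ ∧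
          ob.active ≠ some p₂) ∨
        (¬ t.CondHolds p₁ ∧ ∃ fs, t.procs p₂ = some ⟨pr₁.obj, fs⟩ ∧ Returning fs)))
    ⟨hp₁, ob, ho₂, .inl ⟨hp₂, ha⟩⟩ ?_ ?_ hdep
  · rintro t u ⟨ht₁, ob, ho, hcase⟩ hi
    obtain ⟨ob', ho', -, hact, -⟩ := hi.objs _ _ ho
    refine ⟨hi.proc_left.trans ht₁, ob', ho', ?_⟩
    rwa [hi.proc_right, hact.ne, hi.cond]
  · rintro t u ⟨ht₁, ob, ho, hcase⟩ hm hst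
    have hreturning : ¬ t.CondHolds p₁ ∧
        (∃ ob', u.objs pr₁.obj = some ob' ∧ ob'.fields = ob.fields) ∧
        ∃ fs, u.procs p₂ = some ⟨pr₁.obj, fs⟩ ∧ Returning fs := by
      obtain ⟨ht₂, ha⟩ | ⟨hc, fs, ht₂, hfs⟩ := hcase
      · obtain ⟨hidle, hu⟩ := hst.returning_of_await ht₂ ho ha
        exact ⟨fun hc => hm ((hw₁.mayContinue_iff ht₁ ho).2 ⟨hc, hidle⟩), hu⟩
      · exact ⟨hc, hst.returning ht₂ hfs ho⟩
    obtain ⟨hc, ⟨ob', ho', hfields⟩, hu₂⟩ := hreturning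
    have hu₁ := hst.procs_of_ne hne ht₁
    rw [← hw₁.condHolds_congr hg₁ ht₁ hu₁ ho ho' hfields] at hc
    exact ⟨⟨hu₁, ob', ho', .inr ⟨hc, hu₂⟩⟩, mt State.MayContinue.condHolds hc⟩

end Dependencies

/-! ## Code and stacks of processes on instances of `Mem` -/

/-- The guard of `run`. -/
noncomputable def Mem.pending : Guard := .cond (ne (.field .list) (con .Nil []))

/-- The guard of `internalRead`. -/
noncomputable def Mem.executed : Guard := .cond (contains (.field .done) (.var .myId))

/-- Code of the methods of `Mem` other than `internalRead`: its only guard is that of `run`, it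
contains no `get`, and its synchronous calls are calls on `this` of methods other than
`internalRead`. -/
def Stmt.IsMemCode : Stmt → Prop
  | .skip | .abort | .suspend | .return _ => True
  | .seq s₁ s₂ => s₁.IsMemCode ∧ s₂.IsMemCode
  | .assign _ (.pure _) | .assign _ (.call _ _ _) | .assign _ (.new _ _) => True
  | .assign _ (.sync e m _) => e = .this ∧ m ≠ .internalRead
  | .assign _ (.get _) | .fetch _ _ => False
  | .await g => g = Mem.pending
  | .ite _ s₁ s₂ => s₁.IsMemCode ∧ s₂.IsMemCode
  | .while _ s => s.IsMemCode
  | .caseOf _ _ s₁ s₂ => s₁.IsMemCode ∧ s₂.IsMemCode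

/-- Stacks of processes on instances of `Mem`.  The last two cases are `internalRead` before and at
its guard; it is at the bottom of the stack, as it is only called asynchronously. -/
inductive MemStack : List Frame → Prop
  | code {fs} : (∀ f ∈ fs, ∀ st ∈ f.code, st.IsMemCode) → MemStack fs
  | called {σ d} : MemStack [⟨σ, [Mem.internalRead.body], d⟩]
  | waiting {σ d e} : MemStack [⟨σ, [.await Mem.executed, .return e], d⟩]

namespace Mem

theorem pending_ready_congr {futs : Pid → Option Value} {o : Oid} {σ σ' φ : Store} :
    pending.Ready futs ⟨o, σ, φ⟩ ↔ pending.Ready futs ⟨o, σ', φ⟩ := by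
  simp [pending, Guard.Ready, ne, con, Expr.vals, Expr.valsList]

variable {cfg : MemConfig} {original : Ident}

theorem isMemCode_maySwapDelta {s₁ s₂ : Stmt} (ho : original ≠ .internalRead)
    (h₁ : s₁.IsMemCode) (h₂ : s₂.IsMemCode) :
    (maySwapDelta original s₁ s₂).body.IsMemCode := by
  simp [maySwapDelta, block, setVar, callThis, Stmt.IsMemCode, *]

theorem isMemCode_callOriginal (ho : original ≠ .internalRead) :
    (callOriginal original).IsMemCode := by
  simp [callOriginal, callThis, Stmt.IsMemCode, ho]

theorem isMemCode_orDifferent (ho : original ≠ .internalRead) :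
    (orDifferent original).IsMemCode := by
  simp [orDifferent, callThis, block, setVar, Stmt.IsMemCode, ho]

theorem isMemCode_orSame (ho : original ≠ .internalRead) : (orSame original).IsMemCode := by
  simp [orSame, setVar, isMemCode_callOriginal ho, Stmt.IsMemCode]

theorem isMemCode_of_mem_deltas {delta : Ident → Method} (h : delta ∈ deltas cfg)
    (ho : original ≠ .internalRead) : (delta original).body.IsMemCode := by
  have hdelta : delta = wwDelta ∨ delta = wrOwnDelta ∨ delta = wrDelta := by
    simp only [deltas, List.mem_append, List.mem_ite_nil_right, List.mem_singleton] at h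
    tauto
  obtain rfl | rfl | rfl := hdelta
  · exact isMemCode_maySwapDelta ho (isMemCode_callOriginal ho) (isMemCode_orDifferent ho)
  · exact isMemCode_maySwapDelta ho (isMemCode_orSame ho) (isMemCode_callOriginal ho)
  · exact isMemCode_maySwapDelta ho (isMemCode_orDifferent ho) (isMemCode_callOriginal ho)

variable {md : Method}

theorem isMemCode_maySwap {n : ℕ} (h : maySwap cfg n = some md) : md.body.IsMemCode := by
  cases n with
  | zero =>
    cases h
    trivial
  | succ n =>
    obtain ⟨delta, hdelta, rfl⟩ := Option.map_eq_some_iff.1 h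
    exact isMemCode_of_mem_deltas (List.mem_of_getElem? hdelta) nofun

theorem isMemCode_of_methods {m : Ident} (h : methods cfg m = some md)
    (hm : m ≠ .internalRead) : md.body.IsMemCode := by
  cases m with
  | internalRead => exact absurd rfl hm
  | maySwap | maySwapVersion => exact isMemCode_maySwap h
  | getValueFor =>
    cases h
    split <;> simp [getValueForCore, getValueForReadEarly, block, callThis, Stmt.IsMemCode]
  | _ =>
    cases h <;>
      simp [run, read, write, const, strategy, getAccess, getValueForCore, block, setVar, setField,
        callThis, foreach, Stmt.IsMemCode, pending]

end Mem

namespace MemStack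

variable {cfg : MemConfig} {fs : List Frame}

theorem methodStart {m : Ident} {md : Method} (h : Mem.methods cfg m = some md) (o : Oid)
    (vs : List Value) : MemStack (md.start o vs).frames := by
  by_cases hm : m = .internalRead
  · subst hm
    cases h
    exact .called
  · exact .code (by simpa [Method.start] using Mem.isMemCode_of_methods h hm)

theorem classStart (cfg : MemConfig) (o : Oid) : MemStack ((memClass cfg).start o).frames :=
  .code (by simp [ClassDecl.start, memClass, Mem.methods, block, setField, Stmt.IsMemCode])

theorem tail {σ σ' : Store} {st : Stmt} {k : List Stmt} {d : LVal}
    (h : MemStack (⟨σ, st :: k, d⟩ :: fs)) : MemStack (⟨σ', k, d⟩ :: fs) := by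
  cases h with
  | code h =>
    simp only [List.forall_mem_cons] at h
    exact .code (List.forall_mem_cons.2 ⟨h.1.2, h.2⟩)
  | called => exact .code (by simp)
  | waiting => exact .code (by simp [Stmt.IsMemCode])

theorem isMemCode_assign {σ : Store} {x : LVal} {r : Rhs} {k : List Stmt} {d : LVal}
    (h : MemStack (⟨σ, .assign x r :: k, d⟩ :: fs)) : (Stmt.assign x r).IsMemCode := by
  cases h with
  | code h => exact h _ List.mem_cons_self _ List.mem_cons_self

theorem localStep {self : Oid} {φ φ' : Store} {fs' : List Frame} (h : MemStack fs)
    (hl : LocalStep (Mem.methods cfg) self φ fs φ' fs') : MemStack fs' := by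
  cases h with
  | code h =>
    refine .code ?_
    cases hl with
    | selfCall _ _ hm =>
      have hbody := Mem.isMemCode_of_methods hm (h _ List.mem_cons_self _ List.mem_cons_self).2
      simp only [List.forall_mem_cons] at h ⊢
      tauto
    | _ =>
      simp only [List.forall_mem_cons, Stmt.IsMemCode] at h ⊢
      tauto
  | called =>
    cases hl
    exact .waiting
  | waiting => cases hl

end MemStack

/-! ## The invariant of reachable states -/

/-- The class of an existing object. -/
def State.classOf (s : State) (o : Oid) : Option (Option Ident) := (s.objs o).map Obj.cls

/-- All processes run on existing objects, those on instances of `Mem` with a stack of this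
class. -/
def State.MemInv (s : State) : Prop :=
  ∀ p pr, s.procs p = some pr →
    ∃ C, s.classOf pr.obj = some C ∧ (C = some .Mem → MemStack pr.frames)

section Invariant

variable {cfg : MemConfig} {P : Program} {s s' : State} {p : Pid} {pr : Proc} {o : Oid} {ob : Obj}

theorem State.classOf_eq (ho : s.objs o = some ob) : s.classOf o = some ob.cls := by
  simp [State.classOf, ho]

theorem State.classOf_setObj_self : (s.setObj o ob).classOf o = some ob.cls := by
  simp [State.classOf, State.setObj]

theorem State.classOf_setObj {o' : Oid} {C : Option Ident}
    (ho : ∀ ob', s.objs o = some ob' → ob'.cls = ob.cls) (hC : s.classOf o' = some C) :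
    (s.setObj o ob).classOf o' = some C := by
  by_cases hoo : o' = o
  · subst hoo
    obtain ⟨ob', ho', rfl⟩ := Option.map_eq_some_iff.1 hC
    rw [classOf_setObj_self, ho ob' ho']
  · simpa [State.classOf, State.setObj, hoo] using hC

theorem State.MemInv.memStack (h : s.MemInv) (hp : s.procs p = some pr)
    (ho : s.objs pr.obj = some ob) (hcls : ob.cls = some .Mem) : MemStack pr.frames := by
  obtain ⟨C, hC, hstack⟩ := h p pr hp
  exact hstack (Option.some.inj (hC.symm.trans (State.classOf_eq ho)) ▸ hcls)

theorem State.MemInv.setProc {C : Option Ident} (h : s.MemInv) (hC : s.classOf pr.obj = some C)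
    (hstack : C = some .Mem → MemStack pr.frames) : (s.setProc p pr).MemInv := by
  intro q pr' hq
  by_cases hqp : q = p
  · subst hqp
    obtain rfl : pr = pr' := by simpa [State.setProc] using hq
    exact ⟨C, hC, hstack⟩
  · exact h q pr' (by simpa [State.setProc, hqp] using hq)

theorem State.MemInv.setObj (h : s.MemInv) (ho : ∀ ob', s.objs o = some ob' → ob'.cls = ob.cls) :
    (s.setObj o ob).MemInv := by
  intro q pr hq
  obtain ⟨C, hC, hstack⟩ := h q pr hq
  exact ⟨C, State.classOf_setObj ho hC, hstack⟩

theorem State.MemInv.advance {fs fs' : List Frame} (h : s.MemInv)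
    (hp : s.procs p = some ⟨o, fs⟩) (ho : s.objs o = some ob) (φ : Store) (a : Option Pid)
    (hstack : ob.cls = some .Mem → MemStack fs → MemStack fs') :
    ((s.setObj o ⟨ob.cls, φ, a⟩).setProc p ⟨o, fs'⟩).MemInv :=
  (h.setObj (by simp [ho])).setProc classOf_setObj_self fun hcls =>
    hstack hcls (h.memStack hp ho hcls)

theorem Program.method_mem (hMem : P.classes .Mem = some (memClass cfg)) :
    P.method (some .Mem) = Mem.methods cfg := by
  funext m
  simp [Program.method, hMem, memClass]

theorem State.MemInv.step (hMem : P.classes .Mem = some (memClass cfg)) (h : s.MemInv)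
    (hstep : Step P p s s') : s'.MemInv := by
  have methodStart : ∀ {C m md} o vs, P.method C m = some md → C = some .Mem →
      MemStack (Method.start md o vs).frames := by
    rintro C m md o vs hm rfl
    exact .methodStart (Program.method_mem hMem ▸ hm) o vs
  cases hstep with
  | call hp ho _ _ _ ho' hm =>
    exact (h.advance hp ho _ _ fun _ => .tail).setProc
      (classOf_setObj (by simp [ho]) (classOf_eq ho')) (methodStart _ _ hm)
  | remoteSync hp ho _ he hne _ ho' hm =>
    refine (h.setProc (classOf_eq ho) fun hcls => ?_).setProc (classOf_eq ho') (methodStart _ _ hm)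
    obtain ⟨rfl, -⟩ := (h.memStack hp ho hcls).isMemCode_assign
    simp [Expr.vals, hne] at he
  | @new o ob _ _ _ _ _ _ _ o' cd _ _ hp ho _ _ hC _ ho' =>
    have hne : o' ≠ o := by
      rintro rfl
      cases ho.symm.trans ho'
    refine ((h.advance hp ho _ _ fun _ => .tail).setObj
      (by simp [State.setObj, State.setProc, hne, ho'])).setProc classOf_setObj_self fun hcls => ?_
    cases hcls
    cases hMem.symm.trans hC
    exact .classStart cfg _
  | get hp ho =>
    exact h.setProc (classOf_eq ho) fun hcls => (h.memStack hp ho hcls).isMemCode_assign.elim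
  | fetch hp ho | suspend hp ho | resume hp ho => exact h.advance hp ho _ _ fun _ => .tail
  | release _ ho | activate _ _ ho => exact h.setObj (by simp [ho])
  | finish hp ho | finishUnit hp ho => exact h.advance hp ho _ _ fun _ _ => .code (by simp)
  | _ =>
    rename_i hp ho _ hl
    refine h.advance hp ho _ _ fun hcls hfs => ?_
    rw [hcls, Program.method_mem hMem] at hl
    exact hfs.localStep hl

theorem Reachable.memInv (hMem : P.classes .Mem = some (memClass cfg)) (hs : Reachable P s) :
    s.MemInv := by
  induction hs with
  | refl =>
    intro p pr hp
    obtain ⟨rfl, rfl⟩ : p = 0 ∧ _ = pr := by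
      simpa [Program.initial, Function.update_apply, ite_eq_iff] using hp
    exact ⟨none, by simp [State.classOf, Program.initial], nofun⟩
  | tail _ hstep ih => exact hstep.elim fun _ hstep => ih.step hMem hstep

end Invariant

/-! ## Halting processes on instances of `Mem` -/

section Halting

variable {P : Program} {s : State} {p p₁ p₂ : Pid}

theorem State.MemInv.awaits_of_halting (h : s.MemInv) (hh : s.Halting p) (hr : s.RunsOn p .Mem) :
    ∃ pr ob, s.procs p = some pr ∧ s.objs pr.obj = some ob ∧ ob.active ≠ some p ∧
      ((∃ σ, pr.Awaits Mem.pending σ) ∨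
        (∃ σ, pr.Awaits Mem.executed σ) ∧ pr.AwaitsThenReturns) := by
  obtain ⟨pr, ob, hp, ho, hcls⟩ := hr
  have hstack : MemStack pr.frames := h.memStack hp ho hcls
  obtain ⟨q, ⟨o, σ, x, k, d, fs, hq⟩, -⟩ | ⟨ob', g, env, ⟨o, σ, k, d, fs, hq, -⟩, hn⟩ := hh.1
  · cases hp.symm.trans hq
    cases hstack with
    | code hc => exact (hc _ List.mem_cons_self _ List.mem_cons_self).elim
  · cases hp.symm.trans hq
    refine ⟨_, ob, hp, ho, fun ha => hn ⟨_, ob, hp, ho, ha⟩, ?_⟩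
    cases hstack with
    | code hc =>
      obtain rfl : g = Mem.pending := hc _ List.mem_cons_self _ List.mem_cons_self
      exact .inl ⟨σ, k, d, fs, rfl⟩
    | waiting => exact .inr ⟨⟨σ, _, d, [], rfl⟩, σ, _, _, _, d, rfl⟩

theorem State.MemInv.awaits_pending_of_dependsOn (h : s.MemInv) (hd : DependsOn P s p₁ p₂)
    (hh₂ : s.Halting p₂) (hr₁ : s.RunsOn p₁ .Mem) (hr₂ : s.RunsOn p₂ .Mem) :
    ∃ pr ob σ, s.procs p₂ = some pr ∧ s.objs pr.obj = some ob ∧ ob.active ≠ some p₂ ∧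
      pr.Awaits Mem.pending σ := by
  obtain ⟨pr₁, ob₁, hp₁, ho₁, -, hw₁⟩ := h.awaits_of_halting hd.1 hr₁
  obtain ⟨pr₂, ob₂, hp₂, ho₂, ha₂, ⟨σ₂, hw₂⟩ | ⟨-, hret₂⟩⟩ := h.awaits_of_halting hh₂ hr₂
  · exact ⟨pr₂, ob₂, σ₂, hp₂, ho₂, ha₂, hw₂⟩
  · obtain ⟨e, σ₁, hw₁⟩ : ∃ e σ, pr₁.Awaits (.cond e) σ :=
      hw₁.elim (fun ⟨σ, hw⟩ => ⟨_, σ, hw⟩) fun ⟨⟨σ, hw⟩, _⟩ => ⟨_, σ, hw⟩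
    exact absurd hd (not_dependsOn_of_awaitsThenReturns hp₁ hw₁ (Guard.ignoresFutures_cond e)
      ⟨ob₁, ho₁⟩ hp₂ hret₂ ho₂ ha₂)

end Halting

end ABS

theorem lemma1_general {cfg : ABS.MemConfig} {P : ABS.Program}
    (hMem : P.classes ABS.Ident.Mem = some (ABS.memClass cfg))
    {s : ABS.State} (hs : ABS.Reachable P s) {p₀ p₁ p₂ : ABS.Pid}
    (hr₀ : s.RunsOn p₀ ABS.Ident.Mem) (hr₁ : s.RunsOn p₁ ABS.Ident.Mem)
    (hr₂ : s.RunsOn p₂ ABS.Ident.Mem) (hd₀ : ABS.DependsOn P s p₀ p₁)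
    (hd₁ : ABS.DependsOn P s p₁ p₂) : ¬ s.Halting p₂ := by
  intro hh₂
  have hinv : s.MemInv := hs.memInv hMem
  obtain ⟨pr₁, ob₁, σ₁, hp₁, ho₁, -, hw₁⟩ :=
    hinv.awaits_pending_of_dependsOn hd₀ hd₁.1 hr₀ hr₁
  obtain ⟨pr₂, ob₂, σ₂, hp₂, ho₂, ha₂, hw₂⟩ :=
    hinv.awaits_pending_of_dependsOn hd₁ hh₂ hr₁ hr₂
  have hobj : pr₁.obj = pr₂.obj :=
    hd₁.obj_eq hp₁ hw₁ (ABS.Guard.ignoresFutures_cond _) ho₁ hp₂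
  exact ABS.not_dependsOn_of_ready_imp hp₁ hw₁ hp₂ hw₂ hobj ho₂ ha₂
    (fun _ _ => ABS.Mem.pending_ready_congr.1) hd₁

theorem lemma1 (cfg : ABS.MemConfig) (P : ABS.Program)
    (hMem : P.classes ABS.Ident.Mem = some (ABS.memClass cfg))
    (s : ABS.State) (hs : ABS.Reachable P s) :
    ¬ ∃ (n : ℕ) (c : Fin (n + 2) → ABS.Pid),
      ABS.IsDeadlock P s c ∧ ∀ i, s.RunsOn (c i) ABS.Ident.Mem := by
  rintro ⟨n, c, ⟨-, hdep⟩, hruns⟩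
  exact lemma1_general hMem hs (hruns 0) (hruns _) (hruns _) (hdep 0) (hdep _) (hdep _).1
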